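/- Let $\mathbb{E}$ be the Engel group, i.e. the Carnot group whose Lie algebra is $V_1\oplus V_2\oplus V_3$ with $V_1=\mathrm{span}\{X_1,X_2\}$, $V_2=\mathrm{span}\{X_3\}$, $V_3=\mathrm{span}\{X_4\}$, and whose only non-zero brackets among basis vectors are (up to antisymmetry) $[X_1,X_2]=X_3$ and $[X_1,X_3]=X_4$. Equip $V_1$ with the norm $\|\cdot\|$ for which $X_1,X_2$ are orthonormal, and let $d$ be the Carnot–Carathéodory distance on $\mathbb{E}$, i.e. $d(x,y)$ is the infimum of the lengths $\int_s^t\|\gamma'\|$ of absolutely continuous horizontal curves $\gamma\colon[s,t]\to\mathbb{E}$ joining $x$ to $y$. Let $C^1_H([0,1],\mathbb{E})$ be the set of curves $\gamma\colon[0,1]\to\mathbb{E}$ whose derivative $\gamma'$ (identified with an element of the Lie algebra by left translation) exists, is continuous and takes values in $V_1$, with the metric $$\max\Big(\sup_{t\in[0,1]} d(\gamma_1(t),\gamma_2(t)),\ \sup_{t\in[0,1]}\|\gamma_2'(t)-\gamma_1'(t)\|\Big).$$ A vector $V\in V_1$ is called pliable if, writing $L(t)=\exp(tV)$ for $t\in[0,1]$,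 for every neighborhood $\mathcal{V}$ of $L$ in $C^1_H([0,1],\mathbb{E})$ the set $$\{(\beta(1),\beta'(1)) : \beta\in\mathcal{V},\ (\beta(0),\beta'(0))=(L(0),L'(0))\}$$ is a neighborhood of $(L(1),L'(1))$ in $\mathbb{E}\times V_1$. **Theorem.** For all $a,b\in\mathbb{R}$, the vector $V=aX_1+bX_2\in V_1$ is pliable if and only if either $a\neq 0$ or $a=b=0$. Consequently, the non-pliable vectors of $V_1$ are exactly the vectors $cX_2$ with $c\in\mathbb{R}\setminus\{0\}$. -/

import Mathlib

open Set Filter Topology MeasureTheory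
open scoped ENNReal

noncomputable section

namespace Engel

/-- The manifold underlying the Engel group: `ℝ⁴`, a point `(x₁, x₂, x₃, x₄)` standing for
`exp (x₄ X₄) exp (x₃ X₃) exp (x₂ X₂) exp (x₁ X₁)` (exponential coordinates of the second kind).
Coordinates are indexed from `0` in the code. The norm, the topology and the derivatives are the
Euclidean ones; the sub-Riemannian distance is `ccDist` below. -/
abbrev Point : Type := EuclideanSpace ℝ (Fin 4)

/-- The Lie algebra, as the tangent space at the identity, in the basis `X₁, X₂, X₃, X₄`
(the standard basis, which is declared to be orthonormal). -/
abbrev Alg : Type := EuclideanSpace ℝ (Fin 4)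

instance instMulPoint : Mul Point :=
  ⟨fun x y => !₂[x 0 + y 0, x 1 + y 1, x 2 + y 2 + x 0 * y 1,
    x 3 + y 3 + x 0 * y 2 + x 0 ^ 2 / 2 * y 1]⟩

instance instOnePoint : One Point := ⟨0⟩

instance instInvPoint : Inv Point :=
  ⟨fun x => !₂[-x 0, -x 1, x 0 * x 1 - x 2, x 0 * x 2 - x 0 ^ 2 / 2 * x 1 - x 3]⟩

theorem mul_def (x y : Point) : x * y = !₂[x 0 + y 0, x 1 + y 1, x 2 + y 2 + x 0 * y 1,
    x 3 + y 3 + x 0 * y 2 + x 0 ^ 2 / 2 * y 1] := rfl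

theorem inv_def (x : Point) :
    x⁻¹ = !₂[-x 0, -x 1, x 0 * x 1 - x 2, x 0 * x 2 - x 0 ^ 2 / 2 * x 1 - x 3] := rfl

theorem one_def : (1 : Point) = 0 := rfl

/-- The Engel group. -/
instance instGroupPoint : Group Point :=
  Group.ofLeftAxioms
    (by
      intro x y z
      ext i
      fin_cases i <;> simp [mul_def] <;> ring)
    (by
      intro x
      ext i
      fin_cases i <;> simp [mul_def, one_def])
    (by
      intro x
      ext i
      fin_cases i <;> simp [mul_def, inv_def, one_def] <;> ring)

/-- The left-invariant vector field whose value at the identity is `v`. -/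
def leftField (v : Alg) (x : Point) : Alg := fderiv ℝ (fun y : Point => x * y) 1 v

/-- The basis vectors of the Lie algebra: `basisVec 0 = X₁`, …, `basisVec 3 = X₄`. -/
def basisVec (i : Fin 4) : Alg := EuclideanSpace.single i (1 : ℝ)

/-- The horizontal layer `V₁ = span {X₁, X₂}`, with the norm for which `X₁, X₂` are
orthonormal. -/
def horizontalLayer : Submodule ℝ Alg := Submodule.span ℝ {basisVec 0, basisVec 1}

/-- `X₁` as an element of the horizontal layer. -/
def X₁ : horizontalLayer := ⟨basisVec 0, Submodule.subset_span (by simp)⟩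

/-- `X₂` as an element of the horizontal layer. -/
def X₂ : horizontalLayer := ⟨basisVec 1, Submodule.subset_span (by simp)⟩

/-- The exponential map in these coordinates; `exp_add_smul` and `hasDerivAt_exp_smul` show that
`t ↦ exp (t v)` is the one-parameter subgroup with tangent vector `v` at the identity. -/
def exp (v : Alg) : Point :=
  !₂[v 0, v 1, v 2 + v 0 * v 1 / 2, v 3 + v 0 * v 2 / 2 + v 0 ^ 2 * v 1 / 6]

theorem exp_add_smul (v : Alg) (s t : ℝ) : exp ((s + t) • v) = exp (s • v) * exp (t • v) := by
  ext i
  fin_cases i <;> simp [mul_def, exp] <;> ring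

theorem exp_zero : exp 0 = 1 := by
  ext i
  fin_cases i <;> simp [one_def, exp]

/-- The coordinates are exponential coordinates of the second kind. -/
theorem eq_exp_mul_exp_mul_exp_mul_exp (x : Point) :
    x = exp (x 3 • basisVec 3) * exp (x 2 • basisVec 2) * exp (x 1 • basisVec 1) *
      exp (x 0 • basisVec 0) := by
  ext i
  fin_cases i <;> simp [mul_def, exp, basisVec]

theorem hasDerivAt_toLp {f₀ f₁ f₂ f₃ : ℝ → ℝ} {a₀ a₁ a₂ a₃ t : ℝ} (h₀ : HasDerivAt f₀ a₀ t)
    (h₁ : HasDerivAt f₁ a₁ t) (h₂ : HasDerivAt f₂ a₂ t) (h₃ : HasDerivAt f₃ a₃ t) :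
    HasDerivAt (fun s => (!₂[f₀ s, f₁ s, f₂ s, f₃ s] : EuclideanSpace ℝ (Fin 4)))
      !₂[a₀, a₁, a₂, a₃] t := by
  have h : HasDerivAt (fun s => ![f₀ s, f₁ s, f₂ s, f₃ s]) ![a₀, a₁, a₂, a₃] t := by
    rw [hasDerivAt_pi]
    intro i
    fin_cases i <;> simpa
  exact (PiLp.continuousLinearEquiv 2 ℝ (fun _ : Fin 4 => ℝ)).symm.hasFDerivAt.comp_hasDerivAt t h

theorem contDiff_mul {n : WithTop ℕ∞} : ContDiff ℝ n (fun p : Point × Point => p.1 * p.2) := by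
  rw [contDiff_euclidean]
  intro i
  fin_cases i <;> simp [mul_def] <;> fun_prop

theorem contDiff_inv {n : WithTop ℕ∞} : ContDiff ℝ n (fun p : Point => p⁻¹) := by
  rw [contDiff_euclidean]
  intro i
  fin_cases i <;> simp [inv_def] <;> fun_prop

theorem leftField_eq (v : Alg) (x : Point) :
    leftField v x = !₂[v 0, v 1, v 2 + x 0 * v 1, v 3 + x 0 * v 2 + x 0 ^ 2 / 2 * v 1] := by
  have hd : DifferentiableAt ℝ (fun y : Point => x * y) 1 := by
    have : ContDiff ℝ 1 (fun y : Point => x * y) :=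
      contDiff_mul.comp (contDiff_const.prodMk contDiff_id)
    exact (this.differentiable (by simp)) 1
  have hl : HasDerivAt (fun t : ℝ => t • v) v 0 := by
    simpa using (hasDerivAt_id (0 : ℝ)).smul_const v
  have hc : HasDerivAt (fun t : ℝ => x * (t • v)) (leftField v x) 0 := by
    have h1 : HasFDerivAt (fun y : Point => x * y) (fderiv ℝ (fun y : Point => x * y) 1)
        ((0 : ℝ) • v) := by
      rw [zero_smul, ← one_def]
      exact hd.hasFDerivAt
    exact h1.comp_hasDerivAt (0 : ℝ) hl
  refine hc.unique ?_
  have hlin : ∀ c d : ℝ, HasDerivAt (fun t : ℝ => c + t * d) d 0 := by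
    intro c d
    simpa using ((hasDerivAt_id (0 : ℝ)).mul_const d).const_add c
  have key := hasDerivAt_toLp (hlin (x 0) (v 0)) (hlin (x 1) (v 1))
    (hlin (x 2) (v 2 + x 0 * v 1)) (hlin (x 3) (v 3 + x 0 * v 2 + x 0 ^ 2 / 2 * v 1))
  refine key.congr_of_eventuallyEq (Eventually.of_forall fun t => ?_)
  ext i
  fin_cases i <;> simp [mul_def] <;> ring

theorem hasDerivAt_exp_smul (v : Alg) (t : ℝ) :
    HasDerivAt (fun s : ℝ => exp (s • v)) (leftField v (exp (t • v))) t := by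
  have hp : ∀ c d e : ℝ, HasDerivAt (fun s : ℝ => c * s + d * s ^ 2 + e * s ^ 3)
      (c + d * (2 * t) + e * (3 * t ^ 2)) t := by
    intro c d e
    exact ((((hasDerivAt_id t).const_mul c).add ((hasDerivAt_pow 2 t).const_mul d)).add
      ((hasDerivAt_pow 3 t).const_mul e)).congr_deriv (by simp)
  have key := hasDerivAt_toLp (hp (v 0) 0 0) (hp (v 1) 0 0) (hp (v 2) (v 0 * v 1 / 2) 0)
    (hp (v 3) (v 0 * v 2 / 2) (v 0 ^ 2 * v 1 / 6))
  convert key using 1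
  · funext s
    ext i
    fin_cases i <;> simp [exp] <;> ring
  · rw [leftField_eq]
    ext i
    fin_cases i <;> simp [exp] <;> ring

theorem fderiv_leftField (v w : Alg) (x : Point) :
    fderiv ℝ (leftField v) x w = !₂[0, 0, w 0 * v 1, w 0 * v 2 + x 0 * w 0 * v 1] := by
  have hd : DifferentiableAt ℝ (leftField v) x := by
    have : leftField v = fun x => !₂[v 0, v 1, v 2 + x 0 * v 1,
        v 3 + x 0 * v 2 + x 0 ^ 2 / 2 * v 1] := funext (leftField_eq v)
    rw [this, differentiableAt_euclidean]
    intro i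
    fin_cases i <;> simp <;> fun_prop
  have hl : HasDerivAt (fun t : ℝ => x + t • w) w 0 := by
    simpa using ((hasDerivAt_id (0 : ℝ)).smul_const w).const_add x
  have hc : HasDerivAt (fun t : ℝ => leftField v (x + t • w)) (fderiv ℝ (leftField v) x w) 0 := by
    have h1 : HasFDerivAt (leftField v) (fderiv ℝ (leftField v) x) (x + (0 : ℝ) • w) := by
      rw [zero_smul, add_zero]
      exact hd.hasFDerivAt
    exact h1.comp_hasDerivAt (0 : ℝ) hl
  refine hc.unique ?_
  have hp : ∀ c d e : ℝ, HasDerivAt (fun s : ℝ => c + d * s + e * s ^ 2) d 0 := by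
    intro c d e
    exact ((((hasDerivAt_id (0 : ℝ)).const_mul d).const_add c).add
      ((hasDerivAt_pow 2 (0 : ℝ)).const_mul e)).congr_deriv (by simp)
  have key := hasDerivAt_toLp (hp (v 0) 0 0) (hp (v 1) 0 0) (hp (v 2 + x 0 * v 1) (w 0 * v 1) 0)
    (hp (v 3 + x 0 * v 2 + x 0 ^ 2 / 2 * v 1) (w 0 * v 2 + x 0 * w 0 * v 1)
      (w 0 ^ 2 / 2 * v 1))
  refine key.congr_of_eventuallyEq (Eventually.of_forall fun t => ?_)
  dsimp only
  rw [leftField_eq]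
  ext i
  fin_cases i <;> simp <;> ring

/-- The Lie bracket of left-invariant vector fields. On the basis it says
`[X₁, X₂] = X₃`, `[X₁, X₃] = X₄`, and that all other brackets vanish. -/
theorem lieBracket_leftField (v w : Alg) :
    VectorField.lieBracket ℝ (leftField v) (leftField w) =
      leftField ((v 0 * w 1 - w 0 * v 1) • basisVec 2 +
        (v 0 * w 2 - w 0 * v 2) • basisVec 3) := by
  funext x
  rw [VectorField.lieBracket, fderiv_leftField, fderiv_leftField, leftField_eq, leftField_eq,
    leftField_eq]
  ext i
  fin_cases i <;> simp [basisVec] <;> ring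

/-- `γ : [a, b] → 𝔼` is a horizontal curve with controls `u`, that is, `γ` is absolutely
continuous, `u ∈ L¹([a, b], V₁)`, and `γ̇ = u₁ X₁(γ) + u₂ X₂(γ)` almost everywhere. -/
structure IsHorizontalCurve (a b : ℝ) (γ : ℝ → Point) (u : ℝ → horizontalLayer) : Prop where
  le : a ≤ b
  absolutelyContinuous : AbsolutelyContinuousOnInterval γ a b
  integrable : IntegrableOn u (Icc a b)
  hasDerivAt : ∀ᵐ t ∂volume.restrict (Icc a b), HasDerivAt γ (leftField (u t) (γ t)) t

/-- The Carnot-Carathéodory distance: the infimum of the lengths `∫ |u|` of the horizontal curves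
joining `x` and `y`. It takes values in `[0, ∞]`, so that an infimum over the empty set would be
`∞` and suprema need no boundedness. -/
def ccDist (x y : Point) : ℝ≥0∞ :=
  sInf {L | ∃ (a b : ℝ) (γ : ℝ → Point) (u : ℝ → horizontalLayer),
    IsHorizontalCurve a b γ u ∧ γ a = x ∧ γ b = y ∧ L = ∫⁻ t in Icc a b, ‖u t‖ₑ}

/-- A `C¹` horizontal curve `γ : [a, b] → 𝔼`: the derivative `γ' : [a, b] → V₁` (denoted `vel`)
exists and is continuous. Derivatives at the endpoints are one-sided, and the values of `toFun` and
`vel` outside `[a, b]` play no role. -/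
structure C1HCurve (a b : ℝ) where
  toFun : ℝ → Point
  vel : ℝ → horizontalLayer
  lt : a < b
  continuousOn_vel : ContinuousOn vel (Icc a b)
  hasDerivWithinAt : ∀ t ∈ Icc a b,
    HasDerivWithinAt toFun (leftField (vel t) (toFun t)) (Icc a b) t

/-- The distance on the space of `C¹` horizontal curves on `[a, b]`. -/
def C1HCurve.dist {a b : ℝ} (γ₁ γ₂ : C1HCurve a b) : ℝ≥0∞ :=
  max (⨆ t ∈ Icc a b, ccDist (γ₁.toFun t) (γ₂.toFun t))
    (⨆ t ∈ Icc a b, ‖γ₂.vel t - γ₁.vel t‖ₑ)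

/-- `𝒱` is a neighborhood of `γ` for the distance `C1HCurve.dist`. -/
def C1HCurve.IsNhd {a b : ℝ} (γ : C1HCurve a b) (𝒱 : Set (C1HCurve a b)) : Prop :=
  ∃ ε : ℝ≥0∞, 0 < ε ∧ {β : C1HCurve a b | C1HCurve.dist γ β < ε} ⊆ 𝒱

/-- Pliability of a `C¹` horizontal curve. -/
def C1HCurve.IsPliable {a b : ℝ} (γ : C1HCurve a b) : Prop :=
  ∀ 𝒱 : Set (C1HCurve a b), γ.IsNhd 𝒱 →
    {p : Point × horizontalLayer | ∃ β ∈ 𝒱,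
      (β.toFun a, β.vel a) = (γ.toFun a, γ.vel a) ∧ p = (β.toFun b, β.vel b)} ∈
      𝓝 (γ.toFun b, γ.vel b)

/-- The curve `t ↦ exp (t V)` on `[0, 1]`, for a horizontal vector `V`. -/
def expCurve (V : horizontalLayer) : C1HCurve 0 1 where
  toFun t := exp (t • (V : Alg))
  vel _ := V
  lt := zero_lt_one
  continuousOn_vel := continuousOn_const
  hasDerivWithinAt t _ := (hasDerivAt_exp_smul (V : Alg) t).hasDerivWithinAt

/-- Pliability of a horizontal vector. -/
def IsPliable (V : horizontalLayer) : Prop := (expCurve V).IsPliable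

end Engel

end

noncomputable section

namespace Engel

/-! In coordinates a horizontal curve from the identity with controls `u`, `v` satisfies `x₁' = u`,
`x₂' = v`, `x₃' = x₁ v`, `x₄' = x₁² v / 2`. Once `x₁` is fixed, the other end coordinates are the
moments of `v` against `1`, `x₁`, `x₁² / 2`, hence linear in `v`.

Pliability: let the reference curve have first coordinate `A` and constant second control `b`.
Prescribing `x₁`, `u` and `v` at time `1` is done by polynomial corrections; the three moments are
then corrected by adding `t (1 - t) ∑ cⱼ Aʲ` to `v`. This is a 3 × 3 linear system which for `x₁ =
A` has a weighted Gram matrix of `1, A, A²`, invertible when `A` is not constant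
(`det_momentMatrix_self_ne_zero`). Cramer's rule solves it continuously near the reference endpoint,
with no inverse function theorem (`eventually_exists_lift`). For `a ≠ 0` take `A t = a t`. For `a =
b = 0` replace the constant curve by a small excursion along the `x₁`-axis with the same end data.
The latter case also shows that Euclidean closeness implies closeness for `ccDist`.

Failure for `c X₂`, `c ≠ 0`: on nearby curves `v` keeps the sign of `c`, so `c x₄` is monotone and
points with `c x₄ < 0` are missed. -/

/-- The horizontal curve through the origin with first coordinate `x` and second control `v`. -/
def lift (x v : ℝ → ℝ) (t : ℝ) : Point :=
  !₂[x t, ∫ s in (0 : ℝ)..t, v s, ∫ s in (0 : ℝ)..t, x s * v s,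
    ∫ s in (0 : ℝ)..t, x s ^ 2 / 2 * v s]

theorem lift_zero {x : ℝ → ℝ} (v : ℝ → ℝ) (hx : x 0 = 0) : lift x v 0 = 0 := by
  ext i
  fin_cases i <;> simp [lift, hx]

theorem hasDerivAt_lift {x v : ℝ → ℝ} {x' t : ℝ} (hx : Continuous x) (hv : Continuous v)
    (hx' : HasDerivAt x x' t) :
    HasDerivAt (lift x v) !₂[x', v t, x t * v t, x t ^ 2 / 2 * v t] t := by
  have key : ∀ f : ℝ → ℝ, Continuous f →
      HasDerivAt (fun r => ∫ s in (0 : ℝ)..r, f s) (f t) t := fun f hf =>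
    intervalIntegral.integral_hasDerivAt_right (hf.intervalIntegrable _ _)
      hf.stronglyMeasurable.stronglyMeasurableAtFilter hf.continuousAt
  exact hasDerivAt_toLp hx' (key v hv) (key (fun s => x s * v s) (hx.mul hv))
    (key (fun s => x s ^ 2 / 2 * v s) (by fun_prop))

theorem continuous_toLp {X : Type*} [TopologicalSpace X] {f₀ f₁ f₂ f₃ : X → ℝ}
    (h₀ : Continuous f₀) (h₁ : Continuous f₁) (h₂ : Continuous f₂) (h₃ : Continuous f₃) :
    Continuous (fun s => (!₂[f₀ s, f₁ s, f₂ s, f₃ s] : EuclideanSpace ℝ (Fin 4))) := by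
  refine (PiLp.continuous_toLp 2 (fun _ : Fin 4 => ℝ)).comp (continuous_pi fun i => ?_)
  fin_cases i <;> simpa

theorem continuous_uncurry_lift {X : Type*} [TopologicalSpace X]
    {x v : X → ℝ → ℝ} (hx : Continuous (Function.uncurry x)) (hv : Continuous (Function.uncurry v)) :
    Continuous (fun p : X × ℝ => lift (x p.1) (v p.1) p.2) := by
  refine continuous_toLp hx ?_ ?_ ?_
  · exact intervalIntegral.continuous_parametric_primitive_of_continuous hv
  · exact intervalIntegral.continuous_parametric_primitive_of_continuous
      (f := fun p s => x p s * v p s) (hx.mul hv)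
  · exact intervalIntegral.continuous_parametric_primitive_of_continuous
      (f := fun p s => x p s ^ 2 / 2 * v p s) (((hx.pow 2).div_const 2).mul hv)

/-! ### Invertibility of the moment matrix. -/

/-- A continuous nonconstant function takes at least three values, so that no nonzero quadratic
polynomial vanishes on its range. -/
theorem eq_zero_of_quadratic_comp_eq_zero {A : ℝ → ℝ} (hA : Continuous A) (h0 : A 0 = 0)
    (hhalf : A (1 / 2) ≠ 0) {c : Fin 3 → ℝ}
    (h : ∀ t ∈ Ioo (0 : ℝ) 1, c 0 + c 1 * A t + c 2 * A t ^ 2 = 0) : c = 0 := by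
  have hcl : ∀ t ∈ Icc (0 : ℝ) 1, c 0 + c 1 * A t + c 2 * A t ^ 2 = 0 := by
    have : IsClosed {t | c 0 + c 1 * A t + c 2 * A t ^ 2 = 0} :=
      isClosed_eq (by fun_prop) continuous_const
    have h2 := closure_minimal (s := Ioo (0 : ℝ) 1) h this
    rwa [closure_Ioo zero_ne_one] at h2
  -- With `y = A (1 / 2)`, the polynomial vanishes at the three distinct values `0`, `y / 2`, `y`.
  obtain ⟨m, hm, hAm⟩ : ∃ m ∈ Icc (0 : ℝ) 1, A m = A (1 / 2) / 2 := by
    have hsub := intermediate_value_uIcc (a := (0 : ℝ)) (b := 1 / 2) hA.continuousOn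
    have hmem : A (1 / 2) / 2 ∈ uIcc (A 0) (A (1 / 2)) := by
      rw [h0, mem_uIcc]
      rcases le_total 0 (A (1 / 2)) with h | h
      · left; constructor <;> linarith
      · right; constructor <;> linarith
    obtain ⟨m, hm, h⟩ := hsub hmem
    rw [uIcc_of_le (by norm_num)] at hm
    exact ⟨m, ⟨hm.1, hm.2.trans (by norm_num)⟩, h⟩
  have e0 := hcl 0 (by simp)
  have e1 := hcl (1 / 2) (by constructor <;> norm_num)
  have e2 := hcl m hm
  rw [h0] at e0
  rw [hAm] at e2
  generalize A (1 / 2) = y at *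
  have c0 : c 0 = 0 := by linarith
  have c2 : c 2 = 0 := by
    have : c 2 * y ^ 2 = 0 := by linear_combination 2 * e1 - 4 * e2 + 2 * c0
    simpa [hhalf] using this
  have c1 : c 1 = 0 := by
    have : c 1 * y = 0 := by linear_combination e1 - c0 - y ^ 2 * c2
    simpa [hhalf] using this
  ext i
  fin_cases i <;> simpa

/-- The matrix of the moments `∫ P ^ i A ^ j` for the weight `t (1 - t)` on `[0, 1]`. -/
def momentMatrix (P A : ℝ → ℝ) : Matrix (Fin 3) (Fin 3) ℝ :=
  Matrix.of fun i j => ∫ t in (0 : ℝ)..1, P t ^ (i : ℕ) * (t * (1 - t) * A t ^ (j : ℕ))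

theorem momentMatrix_mulVec {P A : ℝ → ℝ} (hP : Continuous P) (hA : Continuous A)
    (c : Fin 3 → ℝ) (i : Fin 3) : (momentMatrix P A).mulVec c i =
      ∫ t in (0 : ℝ)..1, P t ^ (i : ℕ) * (t * (1 - t) * ∑ j, c j * A t ^ (j : ℕ)) := by
  simp only [Matrix.mulVec, dotProduct, momentMatrix, Matrix.of_apply]
  simp_rw [← intervalIntegral.integral_mul_const]
  rw [← intervalIntegral.integral_finsetSum
    (fun j _ => Continuous.intervalIntegrable (by fun_prop) _ _)]
  congr 1
  ext t
  simp only [Finset.mul_sum]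
  exact Finset.sum_congr rfl fun j _ => by ring

/-- A kernel vector `c` gives `0 = cᵀ M c = ∫ t (1 - t) S²` with `S = ∑ cⱼ Aʲ`. The weight is
positive on `(0, 1)`, so `S` vanishes there. -/
theorem det_momentMatrix_self_ne_zero {A : ℝ → ℝ} (hA : Continuous A) (h0 : A 0 = 0)
    (hhalf : A (1 / 2) ≠ 0) : (momentMatrix A A).det ≠ 0 := by
  intro hdet
  obtain ⟨c, hc, hMc⟩ := Matrix.exists_mulVec_eq_zero_iff.mpr hdet
  apply hc
  set S : ℝ → ℝ := fun t => ∑ j : Fin 3, c j * A t ^ (j : ℕ) with hS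
  have hSc : Continuous S := by fun_prop
  have hint : ∫ t in (0 : ℝ)..1, t * (1 - t) * S t ^ 2 = 0 := by
    have h1 : ∑ i, c i * (momentMatrix A A).mulVec c i = 0 := by simp [hMc]
    simp only [momentMatrix_mulVec hA hA] at h1
    simp_rw [← intervalIntegral.integral_const_mul] at h1
    rw [← intervalIntegral.integral_finsetSum
      (fun j _ => Continuous.intervalIntegrable (by fun_prop) _ _)] at h1
    rw [← h1]
    congr 1
    ext t
    have : ∀ i : Fin 3, c i * (A t ^ (i : ℕ) * (t * (1 - t) * ∑ j, c j * A t ^ (j : ℕ))) =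
        (c i * A t ^ (i : ℕ)) * (t * (1 - t) * S t) := fun i => by simp only [hS]; ring
    simp only [this]
    rw [← Finset.sum_mul]
    change _ = S t * _
    ring
  refine eq_zero_of_quadratic_comp_eq_zero hA h0 hhalf fun t ht => ?_
  by_contra hne
  have hSt : S t ≠ 0 := by
    simpa [hS, Fin.sum_univ_three] using hne
  have hpos := intervalIntegral.integral_pos (a := 0) (b := 1)
    (f := fun t => t * (1 - t) * S t ^ 2) zero_lt_one (by fun_prop)
    (fun s hs => mul_nonneg (mul_nonneg hs.1.le (sub_nonneg.2 hs.2)) (sq_nonneg _))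
    ⟨t, Ioo_subset_Icc_self ht,
      mul_pos (mul_pos ht.1 (sub_pos.2 ht.2)) (by positivity)⟩
  exact hpos.ne' hint

/-! ### Reaching all nearby end data by explicit perturbations. -/

/-- A perturbation of `A` whose value and derivative at `1` change by `s.1` and `s.2.1`. -/
def perturb (A : ℝ → ℝ) (s : ℝ × ℝ × ℝ) (t : ℝ) : ℝ :=
  A t + s.1 * (3 * t ^ 2 - 2 * t ^ 3) + s.2.1 * (t ^ 3 - t ^ 2)

/-- The derivative of `perturb`. -/
def perturbDeriv (A' : ℝ → ℝ) (s : ℝ × ℝ × ℝ) (t : ℝ) : ℝ :=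
  A' t + s.1 * (6 * t - 6 * t ^ 2) + s.2.1 * (3 * t ^ 2 - 2 * t)

/-- The second control: its value at `1` is `b + s.2.2`, and `c` adjusts its moments. -/
def control (A : ℝ → ℝ) (b : ℝ) (s : ℝ × ℝ × ℝ) (c : Fin 3 → ℝ) (t : ℝ) : ℝ :=
  b + s.2.2 * t + t * (1 - t) * ∑ j, c j * A t ^ (j : ℕ)

theorem hasDerivAt_perturb {A : ℝ → ℝ} {A' : ℝ → ℝ} {t : ℝ} (h : HasDerivAt A (A' t) t)
    (s : ℝ × ℝ × ℝ) : HasDerivAt (perturb A s) (perturbDeriv A' s t) t := by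
  have h2 := hasDerivAt_pow 2 t
  have h3 := hasDerivAt_pow 3 t
  refine ((h.add (((h2.const_mul 3).sub (h3.const_mul 2)).const_mul s.1)).add
    ((h3.sub h2).const_mul s.2.1)).congr_deriv ?_
  simp only [perturbDeriv]
  push_cast
  ring

/-- The cubics in `perturb` are Hermite polynomials: value and derivative vanish at `0`, and at `1`
they are `(1, 0)` and `(0, 1)`. The factor `t (1 - t)` in `control` keeps the moment correction from
changing `v 0` and `v 1`. The open set `G` encodes closeness to the reference curve. -/
theorem eventually_exists_lift {A A' : ℝ → ℝ} {a b : ℝ} (hA' : Continuous A')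
    (hA : ∀ t, HasDerivAt A (A' t) t) (h0 : A 0 = 0) (h1 : A 1 = a) (h0' : A' 0 = a)
    (h1' : A' 1 = a) (hhalf : A (1 / 2) ≠ 0) {G : Set (ℝ × Point × ℝ × ℝ)} (hG : IsOpen G)
    (hbase : ∀ t ∈ Icc (0 : ℝ) 1, (t, lift A (fun _ => b) t, A' t, b) ∈ G) :
    ∀ᶠ p : Point × ℝ × ℝ in 𝓝 (lift A (fun _ => b) 1, a, b), ∃ x u v : ℝ → ℝ,
      Continuous u ∧ Continuous v ∧ (∀ t, HasDerivAt x (u t) t) ∧ x 0 = 0 ∧ u 0 = a ∧ v 0 = b ∧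
      lift x v 1 = p.1 ∧ u 1 = p.2.1 ∧ v 1 = p.2.2 ∧
      ∀ t ∈ Icc (0 : ℝ) 1, (t, lift x v t, u t, v t) ∈ G := by
  have hAc : Continuous A := continuous_iff_continuousAt.2 fun t => (hA t).continuousAt
  have hPc : Continuous (fun p : (ℝ × ℝ × ℝ) × ℝ => perturb A p.1 p.2) := by
    unfold perturb; fun_prop
  have hQc : Continuous (fun p : (ℝ × ℝ × ℝ) × ℝ => perturbDeriv A' p.1 p.2) := by
    unfold perturbDeriv; fun_prop
  have hVc : Continuous (fun p : ((ℝ × ℝ × ℝ) × (Fin 3 → ℝ)) × ℝ =>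
      control A b p.1.1 p.1.2 p.2) := by
    unfold control; fun_prop
  set p₀ : Point × ℝ × ℝ := (lift A (fun _ => b) 1, a, b) with hp₀
  let s : Point × ℝ × ℝ → ℝ × ℝ × ℝ := fun p => (p.1 0 - a, p.2.1 - a, p.2.2 - b)
  have hs : Continuous s := by fun_prop
  have hs0 : s p₀ = 0 := by simp [s, p₀, lift, h1]
  have hP0 : perturb A 0 = A := by ext t; simp [perturb]
  have hQ0 : perturbDeriv A' 0 = A' := by ext t; simp [perturbDeriv]
  have hV0 : control A b 0 0 = fun _ => b := by ext t; simp [control]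
  let M : Point × ℝ × ℝ → Matrix (Fin 3) (Fin 3) ℝ := fun p => momentMatrix (perturb A (s p)) A
  have hM : Continuous M := by
    refine continuous_matrix fun i j => ?_
    refine intervalIntegral.continuous_parametric_intervalIntegral_of_continuous'
      (f := fun p t => perturb A (s p) t ^ (i : ℕ) * (t * (1 - t) * A t ^ (j : ℕ))) ?_ 0 1
    have : Continuous (fun q : (Point × ℝ × ℝ) × ℝ => perturb A (s q.1) q.2) :=
      hPc.comp ((hs.comp continuous_fst).prodMk continuous_snd)
    exact (this.pow _).mul (by fun_prop)
  have hM0 : (M p₀).det ≠ 0 := by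
    simp only [M, hs0, hP0]
    exact det_momentMatrix_self_ne_zero hAc h0 hhalf
  -- The moments still missing after the affine part of the control; the `2` appears because the
  -- fourth coordinate is half the second moment.
  let r : Point × ℝ × ℝ → Fin 3 → ℝ := fun p i =>
    ![p.1 1, p.1 2, 2 * p.1 3] i -
      ∫ t in (0 : ℝ)..1, perturb A (s p) t ^ (i : ℕ) * (b + (s p).2.2 * t)
  have hr : Continuous r := by
    refine continuous_pi fun i => Continuous.sub ?_ ?_
    · fin_cases i <;> simp <;> fun_prop
    · refine intervalIntegral.continuous_parametric_intervalIntegral_of_continuous'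
        (f := fun p t => perturb A (s p) t ^ (i : ℕ) * (b + (s p).2.2 * t)) ?_ 0 1
      have : Continuous (fun q : (Point × ℝ × ℝ) × ℝ => perturb A (s q.1) q.2) :=
        hPc.comp ((hs.comp continuous_fst).prodMk continuous_snd)
      exact (this.pow _).mul (by fun_prop)
  have hr0 : r p₀ = 0 := by
    ext i
    simp only [r, hs0, hP0]
    have : (∫ t in (0 : ℝ)..1, A t ^ 2 * b) = 2 * ∫ t in (0 : ℝ)..1, A t ^ 2 / 2 * b := by
      rw [← intervalIntegral.integral_const_mul]
      congr 1
      ext t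
      ring
    fin_cases i
    · simp [p₀, lift]
    · simp [p₀, lift]
    · simp only [p₀, lift]
      simp [this]
  -- Cramer's rule: continuity at `p₀` needs only a nonzero determinant there.
  let c : Point × ℝ × ℝ → Fin 3 → ℝ := fun p => (M p).det⁻¹ • (M p).adjugate.mulVec (r p)
  have hc : ContinuousAt c p₀ := by
    refine ContinuousAt.smul (hM.matrix_det.continuousAt.inv₀ hM0) ?_
    exact (hM.matrix_adjugate.matrix_mulVec hr).continuousAt
  have hc0 : c p₀ = 0 := by simp [c, hr0]
  have hsolve : ∀ p, (M p).det ≠ 0 → (M p).mulVec (c p) = r p := by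
    intro p hp
    simp only [c, Matrix.mulVec_smul, Matrix.mulVec_mulVec, Matrix.mul_adjugate,
      Matrix.smul_mulVec, Matrix.one_mulVec]
    rw [smul_smul, inv_mul_cancel₀ hp, one_smul]
  -- Compactness of `[0, 1]` makes membership in `G` stable uniformly in `t`.
  have htube : ∀ᶠ q : (ℝ × ℝ × ℝ) × (Fin 3 → ℝ) in 𝓝 (0, 0), ∀ t ∈ Icc (0 : ℝ) 1,
      (t, lift (perturb A q.1) (control A b q.1 q.2) t, perturbDeriv A' q.1 t,
        control A b q.1 q.2 t) ∈ G := by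
    refine isCompact_Icc.eventually_forall_of_forall_eventually fun t ht => ?_
    have hcont : Continuous (fun z : ((ℝ × ℝ × ℝ) × (Fin 3 → ℝ)) × ℝ =>
        (z.2, lift (perturb A z.1.1) (control A b z.1.1 z.1.2) z.2, perturbDeriv A' z.1.1 z.2,
          control A b z.1.1 z.1.2 z.2)) := by
      refine continuous_snd.prodMk (Continuous.prodMk ?_ (Continuous.prodMk ?_ hVc))
      · refine continuous_uncurry_lift
          (x := fun q : (ℝ × ℝ × ℝ) × (Fin 3 → ℝ) => perturb A q.1)
          (v := fun q => control A b q.1 q.2) ?_ hVc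
        exact hPc.comp ((continuous_fst.comp continuous_fst).prodMk continuous_snd)
      · exact hQc.comp ((continuous_fst.comp continuous_fst).prodMk continuous_snd)
    refine hcont.continuousAt.eventually_mem (hG.mem_nhds ?_)
    simpa only [hP0, hQ0, hV0] using hbase t ht
  have hsc : Tendsto (fun p => (s p, c p)) (𝓝 p₀) (𝓝 (0, 0)) := by
    have := (hs.continuousAt (x := p₀)).prodMk hc
    rw [ContinuousAt, hs0, hc0] at this
    exact this
  filter_upwards [hsc.eventually htube,
    hM.matrix_det.continuousAt.eventually_ne hM0] with p hp hdet
  have hPp : Continuous (perturb A (s p)) := hPc.comp (continuous_const.prodMk continuous_id)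
  have hVp : Continuous (control A b (s p) (c p)) :=
    hVc.comp (f := fun t : ℝ => ((s p, c p), t)) (by fun_prop)
  have hmoment : ∀ i : Fin 3, ∫ t in (0 : ℝ)..1,
      perturb A (s p) t ^ (i : ℕ) * control A b (s p) (c p) t =
        ![p.1 1, p.1 2, 2 * p.1 3] i := by
    intro i
    have h2 := congrFun (hsolve p hdet) i
    simp only [M, r] at h2
    rw [momentMatrix_mulVec hPp hAc] at h2
    rw [eq_sub_iff_add_eq, ← intervalIntegral.integral_add
      (Continuous.intervalIntegrable (by fun_prop) _ _)
      (Continuous.intervalIntegrable (by fun_prop) _ _)] at h2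
    rw [← h2]
    congr 1
    ext t
    simp only [control]
    ring
  refine ⟨perturb A (s p), perturbDeriv A' (s p), control A b (s p) (c p),
    hQc.comp (continuous_const.prodMk continuous_id), hVp,
    fun t => hasDerivAt_perturb (hA t) _, ?_, ?_, ?_, ?_, ?_, ?_, hp⟩
  · simp [perturb, h0]
  · simp [perturbDeriv, h0']
  · simp [control]
  · have m0 := hmoment 0
    have m1 := hmoment 1
    have m2 := hmoment 2
    simp only [Fin.val_zero, Fin.val_one, Fin.val_two, pow_zero, pow_one, one_mul] at m0 m1 m2
    have m2' : ∫ t in (0 : ℝ)..1, perturb A (s p) t ^ 2 / 2 * control A b (s p) (c p) t =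
        p.1 3 := by
      have : ∀ t, perturb A (s p) t ^ 2 / 2 * control A b (s p) (c p) t =
          1 / 2 * (perturb A (s p) t ^ 2 * control A b (s p) (c p) t) := fun t => by ring
      simp_rw [this]
      rw [intervalIntegral.integral_const_mul, m2]
      simp
    ext i
    fin_cases i
    · simp [lift, perturb, h1, s]
      ring
    · simpa [lift] using m0
    · simpa [lift] using m1
    · simpa [lift] using m2'
  · simp [perturbDeriv, h1', s]
    ring
  · simp [control, s]

/-! ### Horizontal vectors, left invariance and lengths. -/

theorem coe_smul_X₁_add_smul_X₂ (a b : ℝ) :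
    ((a • X₁ + b • X₂ : horizontalLayer) : Alg) = !₂[a, b, 0, 0] := by
  ext i
  fin_cases i <;> simp [X₁, X₂, basisVec]

theorem eq_smul_X₁_add_smul_X₂ (V : horizontalLayer) :
    V = (V : Alg) 0 • X₁ + (V : Alg) 1 • X₂ := by
  obtain ⟨a, b, h⟩ := Submodule.mem_span_pair.1 V.2
  have h' : a • X₁ + b • X₂ = V := Subtype.ext h
  have h2 := coe_smul_X₁_add_smul_X₂ a b
  rw [h'] at h2
  rw [h2, ← h']
  simp

theorem leftField_smul_X₁_add_smul_X₂ (u v : ℝ) (x : Point) :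
    leftField (u • X₁ + v • X₂ : horizontalLayer) x = !₂[u, v, x 0 * v, x 0 ^ 2 / 2 * v] := by
  rw [leftField_eq, coe_smul_X₁_add_smul_X₂]
  ext i
  fin_cases i <;> simp

theorem differentiable_mul_left (x : Point) : Differentiable ℝ (fun y : Point => x * y) :=
  ((contDiff_mul (n := 1)).comp (contDiff_const.prodMk contDiff_id)).differentiable (by simp)

/-- Chain rule for `L_{xy} = L_x ∘ L_y` at the identity. -/
theorem leftField_mul (v : Alg) (x y : Point) :
    leftField v (x * y) = fderiv ℝ (fun z : Point => x * z) y (leftField v y) := by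
  have h : (fun z : Point => x * y * z) = (fun z => x * z) ∘ (fun z => y * z) := by
    ext1 z
    exact mul_assoc x y z
  rw [leftField, h, fderiv_comp _ (differentiable_mul_left x _) (differentiable_mul_left y _),
    mul_one]
  rfl

theorem hasDerivAt_mul_left {γ : ℝ → Point} {v : Alg} {t : ℝ}
    (h : HasDerivAt γ (leftField v (γ t)) t) (x : Point) :
    HasDerivAt (fun s => x * γ s) (leftField v (x * γ t)) t := by
  rw [leftField_mul]
  exact (differentiable_mul_left x (γ t)).hasFDerivAt.comp_hasDerivAt t h

theorem ccDist_le {γ : ℝ → Point} {u : ℝ → horizontalLayer} (hu : Continuous u)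
    (h : ∀ t, HasDerivAt γ (leftField (u t) (γ t)) t) {δ : ℝ≥0∞}
    (hδ : ∀ t ∈ Icc (0 : ℝ) 1, ‖u t‖ₑ ≤ δ) : ccDist (γ 0) (γ 1) ≤ δ := by
  have hγ : Continuous γ := continuous_iff_continuousAt.2 fun t => (h t).continuousAt
  have hd : Continuous (fun t => leftField (u t) (γ t)) := by
    simp only [leftField_eq]
    have h1 : Continuous (fun t => ((u t : Alg))) := continuous_subtype_val.comp hu
    exact continuous_toLp (by fun_prop) (by fun_prop) (by fun_prop) (by fun_prop)
  obtain ⟨C, hC⟩ := isCompact_Icc.exists_bound_of_continuousOn (s := Icc (0 : ℝ) 1) hd.continuousOn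
  have hlip : LipschitzOnWith C.toNNReal γ (uIcc 0 1) := by
    rw [uIcc_of_le zero_le_one]
    refine (convex_Icc 0 1).lipschitzOnWith_of_nnnorm_hasDerivWithin_le
      (fun t _ => (h t).hasDerivWithinAt) fun t ht => ?_
    rw [← NNReal.coe_le_coe, coe_nnnorm]
    exact (hC t ht).trans (Real.le_coe_toNNReal C)
  have hcurve : IsHorizontalCurve 0 1 γ u :=
    ⟨zero_le_one, hlip.absolutelyContinuousOnInterval, hu.continuousOn.integrableOn_Icc,
      Eventually.of_forall h⟩
  have hle : ccDist (γ 0) (γ 1) ≤ ∫⁻ t in Icc (0 : ℝ) 1, ‖u t‖ₑ :=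
    sInf_le ⟨0, 1, γ, u, hcurve, rfl, rfl, rfl⟩
  calc ccDist (γ 0) (γ 1) ≤ ∫⁻ t in Icc (0 : ℝ) 1, ‖u t‖ₑ := hle
    _ ≤ ∫⁻ _ in Icc (0 : ℝ) 1, δ := setLIntegral_mono measurable_const hδ
    _ = δ := by simp

theorem hasDerivAt_lift_leftField {x u v : ℝ → ℝ} (hx : ∀ t, HasDerivAt x (u t) t)
    (hv : Continuous v) (t : ℝ) : HasDerivAt (lift x v)
      (leftField (u t • X₁ + v t • X₂ : horizontalLayer) (lift x v t)) t := by
  rw [leftField_smul_X₁_add_smul_X₂]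
  exact hasDerivAt_lift (continuous_iff_continuousAt.2 fun t => (hx t).continuousAt) hv (hx t)

/-! ### Choice of the reference curve. -/

/-- Every point and velocity near the endpoint of `t ↦ exp (t (a X₁ + b X₂))` is attained by a
horizontal curve near it, provided that `a ≠ 0` or `a = b = 0`. -/
theorem eventually_exists_lift_of_exp {a b : ℝ} (hab : a ≠ 0 ∨ (a = 0 ∧ b = 0))
    {G : Set (ℝ × Point × ℝ × ℝ)} (hG : IsOpen G)
    (hbase : ∀ t ∈ Icc (0 : ℝ) 1, (t, exp (t • !₂[a, b, 0, 0]), a, b) ∈ G) :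
    ∀ᶠ p : Point × ℝ × ℝ in 𝓝 (exp !₂[a, b, 0, 0], a, b), ∃ x u v : ℝ → ℝ,
      Continuous u ∧ Continuous v ∧ (∀ t, HasDerivAt x (u t) t) ∧ x 0 = 0 ∧ u 0 = a ∧ v 0 = b ∧
      lift x v 1 = p.1 ∧ u 1 = p.2.1 ∧ v 1 = p.2.2 ∧
      ∀ t ∈ Icc (0 : ℝ) 1, (t, lift x v t, u t, v t) ∈ G := by
  rcases hab with ha | ⟨rfl, rfl⟩
  · have hlift : ∀ t, lift (fun t => a * t) (fun _ => b) t = exp (t • !₂[a, b, 0, 0]) := by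
      intro t
      have e : ∀ s : ℝ, (a * s) ^ 2 / 2 * b = a ^ 2 / 2 * b * s ^ 2 := fun s => by ring
      ext i
      fin_cases i
      · simp [lift, exp, mul_comm]
      · simp [lift, exp]
      · have e' : ∫ s in (0 : ℝ)..t, a * s = a * t ^ 2 / 2 := by
          rw [intervalIntegral.integral_const_mul, integral_id]
          ring
        simp [lift, exp, e']
        ring
      · simp [lift, exp, e]
        ring
    have h1 := hlift 1
    rw [one_smul] at h1
    rw [← h1]
    refine eventually_exists_lift continuous_const (A' := fun _ => a) (fun t => ?_) (by simp)
      (by simp) rfl rfl (by simpa using ha) hG fun t ht => ?_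
    · simpa using (hasDerivAt_id t).const_mul a
    · rw [hlift]
      exact hbase t ht
  · have hlift : ∀ (x : ℝ → ℝ) (t : ℝ), lift x (fun _ => 0) t = !₂[x t, 0, 0, 0] := by
      intro x t
      ext i
      fin_cases i <;> simp [lift]
    -- The first coordinate `0` is constant, so the reference becomes `η t² (1 - t)²`, which
    -- vanishes with its derivative at both ends; small `η` keeps it in `G`, and `η ≠ 0` makes it
    -- nonconstant.
    have htube : ∀ᶠ η : ℝ in 𝓝 0, ∀ t ∈ Icc (0 : ℝ) 1,
        (t, (!₂[η * (t ^ 2 - 2 * t ^ 3 + t ^ 4), 0, 0, 0] : Point),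
          η * (2 * t - 6 * t ^ 2 + 4 * t ^ 3), (0 : ℝ)) ∈ G := by
      refine isCompact_Icc.eventually_forall_of_forall_eventually fun t ht => ?_
      have hcont : Continuous (fun z : ℝ × ℝ =>
          (z.2, (!₂[z.1 * (z.2 ^ 2 - 2 * z.2 ^ 3 + z.2 ^ 4), 0, 0, 0] : Point),
            z.1 * (2 * z.2 - 6 * z.2 ^ 2 + 4 * z.2 ^ 3), (0 : ℝ))) := by
        refine continuous_snd.prodMk (Continuous.prodMk ?_ (by fun_prop))
        exact continuous_toLp (by fun_prop) continuous_const continuous_const continuous_const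
      refine hcont.continuousAt.eventually_mem (hG.mem_nhds ?_)
      convert hbase t ht using 3
      · ext i
        fin_cases i <;> simp [exp]
      · simp
    obtain ⟨η, hη, hη0⟩ := ((htube.filter_mono nhdsWithin_le_nhds).and
      (self_mem_nhdsWithin (s := {(0 : ℝ)}ᶜ))).exists
    have hend : exp !₂[0, 0, 0, 0] =
        lift (fun t => η * (t ^ 2 - 2 * t ^ 3 + t ^ 4)) (fun _ => 0) 1 := by
      rw [hlift]
      ext i
      fin_cases i <;> simp [exp]
      norm_num
    rw [hend]
    refine eventually_exists_lift (A' := fun t => η * (2 * t - 6 * t ^ 2 + 4 * t ^ 3))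
      (by fun_prop) (fun t => ?_) (by simp) (by norm_num) (by simp) (by norm_num) ?_ hG
      fun t ht => ?_
    · refine ((((hasDerivAt_pow 2 t).sub ((hasDerivAt_pow 3 t).const_mul 2)).add
        (hasDerivAt_pow 4 t)).const_mul η).congr_deriv ?_
      push_cast
      ring
    · refine mul_ne_zero hη0 (by norm_num)
    · rw [hlift]
      exact hη t ht

/-! ### From Euclidean to Carnot–Carathéodory closeness, and pliability. -/

theorem continuous_smul_X₁_add_smul_X₂ :
    Continuous (fun p : ℝ × ℝ => (p.1 • X₁ + p.2 • X₂ : horizontalLayer)) := by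
  fun_prop

/-- Left translation by points near the identity moves points by a small distance. -/
theorem eventually_ccDist_mul_le {δ : ℝ≥0∞} (hδ : 0 < δ) :
    ∀ᶠ z : Point in 𝓝 1, ∀ x : Point, ccDist x (x * z) ≤ δ := by
  have hG : IsOpen {q : ℝ × Point × ℝ × ℝ |
      ‖(q.2.2.1 • X₁ + q.2.2.2 • X₂ : horizontalLayer)‖ₑ < δ} := by
    refine isOpen_lt (Continuous.enorm ?_) continuous_const
    exact continuous_smul_X₁_add_smul_X₂.comp (continuous_snd.comp continuous_snd)
  -- Around the constant curve, `G` bounds only the controls, hence the length; left translation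
  -- then moves the starting point to any `y`.
  have h := eventually_exists_lift_of_exp (a := 0) (b := 0) (Or.inr ⟨rfl, rfl⟩) hG
    fun t _ => by simpa [-enorm_zero, enorm_zero (E := horizontalLayer)] using hδ
  have hend : exp !₂[0, 0, 0, 0] = 1 := by
    rw [← exp_zero]
    congr 1
    ext i
    fin_cases i <;> rfl
  rw [hend] at h
  have hcont : Continuous (fun z : Point => (z, (0 : ℝ), (0 : ℝ))) := by fun_prop
  filter_upwards [hcont.continuousAt.eventually h] with z
    ⟨x, u, v, hu, hv, hx, hx0, _, _, hz, _, _, hmem⟩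
  intro y
  have hd := fun t => hasDerivAt_mul_left (hasDerivAt_lift_leftField hx hv t) y
  have hle := ccDist_le (continuous_smul_X₁_add_smul_X₂.comp (hu.prodMk hv)) hd
    fun t ht => (hmem t ht).le
  rwa [lift_zero v hx0, ← one_def, mul_one, hz] at hle

theorem isPliable_of_ne_zero_or_eq_zero {a b : ℝ} (hab : a ≠ 0 ∨ (a = 0 ∧ b = 0)) :
    IsPliable (a • X₁ + b • X₂) := by
  rintro 𝒱 ⟨ε, hε, h𝒱⟩
  -- Suprema over `t` preserve only `≤ δ`, so strict room below `ε` is needed.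
  obtain ⟨δ, hδ, hδε⟩ := exists_between hε
  obtain ⟨W, hWsub, hWopen, hW1⟩ := eventually_nhds_iff.1 (eventually_ccDist_mul_le hδ)
  set V : horizontalLayer := a • X₁ + b • X₂ with hV
  have hVc : (V : Alg) = !₂[a, b, 0, 0] := coe_smul_X₁_add_smul_X₂ a b
  have hexp : Continuous (fun t : ℝ => exp (t • (V : Alg))) :=
    continuous_iff_continuousAt.2 fun t => (hasDerivAt_exp_smul (V : Alg) t).continuousAt
  -- The first condition is Euclidean-open and forces `ccDist` from `exp (t V)` to be at most `δ`.
  have hG : IsOpen {q : ℝ × Point × ℝ × ℝ | (exp (q.1 • (V : Alg)))⁻¹ * q.2.1 ∈ W ∧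
      ‖(q.2.2.1 • X₁ + q.2.2.2 • X₂ : horizontalLayer) - V‖ₑ < δ} := by
    refine IsOpen.inter (hWopen.preimage ?_) (isOpen_lt (Continuous.enorm ?_) continuous_const)
    · exact (contDiff_mul (n := 0)).continuous.comp
        (((contDiff_inv (n := 0)).continuous.comp (hexp.comp continuous_fst)).prodMk
          (continuous_fst.comp continuous_snd))
    · exact (continuous_smul_X₁_add_smul_X₂.comp
        (continuous_snd.comp continuous_snd)).sub continuous_const
  have h := eventually_exists_lift_of_exp hab hG fun t _ => by
    rw [← hVc]
    exact ⟨by simpa using hW1, by simpa only [← hV, sub_self, enorm_zero (E := horizontalLayer)] using hδ⟩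
  rw [← hVc] at h
  have hcont : Continuous (fun p : Point × horizontalLayer =>
      (p.1, (p.2 : Alg) 0, (p.2 : Alg) 1)) := by fun_prop
  have hpt : (fun p : Point × horizontalLayer => (p.1, (p.2 : Alg) 0, (p.2 : Alg) 1))
      (exp V, V) = (exp V, a, b) := by simp [hVc]
  have h' := hcont.continuousAt (x := ((exp (V : Alg), V) : Point × horizontalLayer))
  rw [ContinuousAt] at h'
  change Tendsto _ _ (𝓝 ((fun p : Point × horizontalLayer =>
    (p.1, (p.2 : Alg) 0, (p.2 : Alg) 1)) (exp V, V))) at h'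
  rw [hpt] at h'
  have hgoal : ((expCurve V).toFun 1, (expCurve V).vel 1) = (exp (V : Alg), V) := by
    simp [expCurve]
  rw [hgoal]
  filter_upwards [h'.eventually h] with ⟨z, w⟩
    ⟨x, u, v, hu, hv, hx, hx0, hu0, hv0, hz, hu1, hv1, hmem⟩
  have huv : Continuous fun t => (u t • X₁ + v t • X₂ : horizontalLayer) :=
    continuous_smul_X₁_add_smul_X₂.comp (hu.prodMk hv)
  let β : C1HCurve 0 1 :=
    { toFun := lift x v
      vel := fun t => u t • X₁ + v t • X₂
      lt := zero_lt_one
      continuousOn_vel := huv.continuousOn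
      hasDerivWithinAt := fun t _ => (hasDerivAt_lift_leftField hx hv t).hasDerivWithinAt }
  refine ⟨β, h𝒱 (lt_of_le_of_lt (max_le ?_ ?_) hδε), ?_, ?_⟩
  · refine iSup₂_le fun t ht => ?_
    have hle := hWsub _ (hmem t ht).1 (exp (t • (V : Alg)))
    rwa [mul_inv_cancel_left] at hle
  · exact iSup₂_le fun t ht => (hmem t ht).2.le
  · simp only [β, expCurve, lift_zero v hx0, hu0, hv0, zero_smul, exp_zero]
    rfl
  · simp only [β, hz, hu1, hv1, ← eq_smul_X₁_add_smul_X₂]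

/-! ### Non-pliability of nonzero multiples of `X₂`. -/

/-- Near `t ↦ exp (t c X₂)` the fourth coordinate of a horizontal curve is monotone. -/
theorem not_isPliable_smul_X₂ {c : ℝ} (hc : c ≠ 0) : ¬ IsPliable (c • X₂) := by
  intro hp
  have hVc : ((c • X₂ : horizontalLayer) : Alg) = !₂[0, c, 0, 0] := by
    simpa using coe_smul_X₁_add_smul_X₂ 0 c
  -- Radius `|c|` is just what forces the second control to have the sign of `c`.
  have hnhds := hp {β | C1HCurve.dist (expCurve (c • X₂)) β < ‖c‖ₑ}
    ⟨‖c‖ₑ, by simpa using hc, subset_rfl⟩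
  -- Candidate unreachable endpoints, for `δ > 0`: the velocity is unchanged and the fourth
  -- coordinate has sign opposite to `c`.
  have hcont : Continuous (fun δ : ℝ => ((!₂[0, c, 0, -(c * δ)] : Point), c • X₂)) :=
    (continuous_toLp continuous_const continuous_const continuous_const
      (by fun_prop)).prodMk continuous_const
  have h0 : ((!₂[0, c, 0, -(c * 0)] : Point), c • X₂) =
      ((expCurve (c • X₂)).toFun 1, (expCurve (c • X₂)).vel 1) := by
    refine Prod.ext ?_ rfl
    simp only [expCurve, hVc]
    ext i
    fin_cases i <;> simp [exp]
  have ht := hcont.tendsto 0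
  rw [h0] at ht
  obtain ⟨δ, ⟨β, hβ, hβ0, hβ1⟩, hδ⟩ := (((ht.eventually hnhds).filter_mono
    nhdsWithin_le_nhds).and (self_mem_nhdsWithin (s := Ioi (0 : ℝ)))).exists
  have hvel : ∀ t ∈ Icc (0 : ℝ) 1, 0 ≤ c * (β.vel t : Alg) 1 := by
    intro t ht
    have h1 : ‖β.vel t - c • X₂‖ₑ < ‖c‖ₑ :=
      ((le_iSup₂ (f := fun t (_ : t ∈ Icc (0 : ℝ) 1) => ‖β.vel t - c • X₂‖ₑ) t ht).trans
        (le_max_right _ _)).trans_lt hβ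
    rw [← ofReal_norm, ← ofReal_norm, ENNReal.ofReal_lt_ofReal_iff (norm_pos_iff.2 hc)] at h1
    have h2 := PiLp.norm_apply_le ((β.vel t - c • X₂ : horizontalLayer) : Alg) 1
    rw [Submodule.coe_sub, hVc] at h2
    have h3 : |(β.vel t : Alg) 1 - c| < |c| := by
      refine lt_of_le_of_lt ?_ h1
      change _ ≤ ‖((β.vel t - c • X₂ : horizontalLayer) : Alg)‖
      rw [Submodule.coe_sub, hVc]
      simpa using h2
    nlinarith [sq_lt_sq.2 h3, sq_nonneg ((β.vel t : Alg) 1)]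
  have hder : ∀ t ∈ Icc (0 : ℝ) 1, HasDerivWithinAt (fun t => c * β.toFun t 3)
      (c * leftField (β.vel t) (β.toFun t) 3) (Icc 0 1) t := fun t ht =>
    ((EuclideanSpace.proj (𝕜 := ℝ) (3 : Fin 4)).hasFDerivAt.comp_hasDerivWithinAt t
      (β.hasDerivWithinAt t ht)).const_mul c
  have hmono : MonotoneOn (fun t => c * β.toFun t 3) (Icc 0 1) := by
    refine monotoneOn_of_hasDerivWithinAt_nonneg (convex_Icc 0 1)
      (fun t ht => (hder t ht).continuousWithinAt)
      (fun t ht => (hder t (interior_subset ht)).mono interior_subset) fun t ht => ?_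
    -- The derivative of `c x₄` is `c v x₁² / 2`.
    rw [eq_smul_X₁_add_smul_X₂ (β.vel t), leftField_smul_X₁_add_smul_X₂]
    have := mul_nonneg (hvel t (interior_subset ht)) (sq_nonneg (β.toFun t 0))
    simp
    nlinarith
  have hle := hmono (left_mem_Icc.2 zero_le_one) (right_mem_Icc.2 zero_le_one) zero_le_one
  have e0 : β.toFun 0 = 0 := by
    have := congrArg Prod.fst hβ0
    simpa [expCurve, exp_zero, one_def] using this
  have e1 : β.toFun 1 = !₂[0, c, 0, -(c * δ)] := (congrArg Prod.fst hβ1).symm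
  simp only [e0, e1] at hle
  simp at hle
  have : 0 < c ^ 2 * δ := mul_pos (by positivity) hδ
  nlinarith

end Engel

end

theorem theorem4p1 :
    (∀ a b : ℝ, Engel.IsPliable (a • Engel.X₁ + b • Engel.X₂) ↔ (a ≠ 0 ∨ (a = 0 ∧ b = 0))) ∧
    (∀ V : Engel.horizontalLayer,
      ¬ Engel.IsPliable V ↔ ∃ c : ℝ, c ≠ 0 ∧ V = c • Engel.X₂) := by
  have key : ∀ a b : ℝ,
      Engel.IsPliable (a • Engel.X₁ + b • Engel.X₂) ↔ (a ≠ 0 ∨ (a = 0 ∧ b = 0)) := by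
    refine fun a b => ⟨fun h => ?_, Engel.isPliable_of_ne_zero_or_eq_zero⟩
    by_contra! hab
    obtain ⟨rfl, hb⟩ := hab
    rw [zero_smul, zero_add] at h
    exact Engel.not_isPliable_smul_X₂ (hb rfl) h
  refine ⟨key, fun V => ⟨fun h => ?_, ?_⟩⟩
  · rw [Engel.eq_smul_X₁_add_smul_X₂ V, key] at h
    push Not at h
    refine ⟨(V : Engel.Alg) 1, h.2 h.1, ?_⟩
    conv_lhs => rw [Engel.eq_smul_X₁_add_smul_X₂ V, h.1, zero_smul, zero_add]
  · rintro ⟨c, hc, rfl⟩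
    exact Engel.not_isPliable_smul_X₂ hc
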